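/- Let $n\ge 0$ and write permutations $\sigma\in\mathfrak S_{2n}$ as words $\sigma_1\cdots\sigma_{2n}$. A descent of $\sigma$ is a pair $(\sigma_i,\sigma_{i+1})$ with $\sigma_i>\sigma_{i+1}$; $\sigma_i$ is its descent top and $\sigma_{i+1}$ its descent bottom, and $\operatorname{des}\sigma$ is the number of descents. Let $\operatorname{les}\sigma$ be the number of pairs $(i,j)$ with $2\le i<j\le 2n$ and $\sigma_{i-1}>\sigma_j>\sigma_i$, and let $\operatorname{res}\sigma$ be the number of pairs $(i,j)$ with $1\le i<j\le 2n-1$ and $\sigma_j>\sigma_i>\sigma_{j+1}$. For a letter $x$, let $l_\sigma(x)$ (resp. $r_\sigma(x)$) be the number of descents $(\sigma_i,\sigma_{i+1})$ located to the left (resp. right) of $x$ with $\sigma_i>x>\sigma_{i+1}$. Let $\mathcal X_{2n}$ be the set of $\sigma\in\mathfrak S_{2n}$ all of whose descents have an even top and an odd bottom. Let $\overline{\mathcal X}_{2n,k}$ be the set of $E$-permutations with $k$ descents, that is, of those $\sigma\in\mathcal X_{2n}$ with $\operatorname{des}\sigma=k$ such that for no $j\in[n]$ are $2j-1$ and $2j$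 simultaneously a descent bottom and a descent top of $\sigma$. For $\sigma\in\mathcal X_{2n}$ let $S=S_\sigma$ be the set of its descent tops and descent bottoms and, for $x\in[2n]$, let $$s(x)=\#\{y\in S: y<x,\ y\text{ odd}\}-\#\{y\in S: y<x,\ y\text{ even}\}+\varepsilon(x),$$ where $\varepsilon(x)=1$ if $x\notin S$ or $x$ is odd, and $\varepsilon(x)=0$ otherwise. An $E$-permutation $\sigma$ is normalized if for every $j\in[n]$: (a) if $2j-1\in S$ and $s(2j-1)$ is odd, then $l_\sigma(2j)$ is even; (b) if $2j-1\in S$ and $s(2j-1)$ is even, then $l_\sigma(2j-1)$ is even; (c) if $2j\in S$ and $s(2j)$ is odd, then $r_\sigma(2j-1)$ is even; (d) if $2j\in S$ and $s(2j)$ is even, then $r_\sigma(2j)$ is even. Let $\widehat{\mathcal X}_{2n,k}$ be the set of normalized $E$-permutations with $k$ descents. **Theorem.** In $\mathbb Z[p,q,t]$ (equivalently, for all elements $p,q,t$ of any commutative ring), $$\sum_{\sigma\in\mathcal X_{2n}}p^{\operatorname{res}\sigma}q^{\operatorname{les}\sigma}t^{\operatorname{des}\sigma}=\sum_{k=0}^{\lfloor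 n/2\rfloor}\gamma_{n,k}(p,q)\,t^k(1+t)^{n-2k},\qquad \gamma_{n,k}(p,q)=\sum_{\sigma\in\overline{\mathcal X}_{2n,k}}p^{\operatorname{res}\sigma}q^{\operatorname{les}\sigma}.$$ Moreover, for every $k\ge 0$, every $\sigma\in\widehat{\mathcal X}_{2n,k}$ satisfies $\operatorname{les}\sigma\ge k$ and $\operatorname{res}\sigma\ge k$, and $$\gamma_{n,k}(p,q)=(p+q)^{2k}\sum_{\sigma\in\widehat{\mathcal X}_{2n,k}}q^{\operatorname{les}\sigma-k}p^{\operatorname{res}\sigma-k}.$$ -/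

import Mathlib

/-- The letter `σ_i` of a permutation of `[m]` written as a word: positions and values of
`Equiv.Perm (Fin m)` start from `0`, the letters of the word are `1, …, m`. -/
def letter {m : ℕ} (σ : Equiv.Perm (Fin m)) (i : Fin m) : ℕ := (σ i : ℕ) + 1

/-- The descents of `σ`, as the pairs `(i, i + 1)` of consecutive positions with
`σ_i > σ_{i+1}`; `σ_i` is the descent top and `σ_{i+1}` the descent bottom. -/
def descents {m : ℕ} (σ : Equiv.Perm (Fin m)) : Finset (Fin m × Fin m) :=
  Finset.univ.filter fun d => (d.1 : ℕ) + 1 = (d.2 : ℕ) ∧ letter σ d.2 < letter σ d.1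

/-- The number of descents. -/
def des {m : ℕ} (σ : Equiv.Perm (Fin m)) : ℕ := (descents σ).card

/-- The set of descent tops. -/
def descentTops {m : ℕ} (σ : Equiv.Perm (Fin m)) : Finset ℕ :=
  (descents σ).image fun d => letter σ d.1

/-- The set of descent bottoms. -/
def descentBottoms {m : ℕ} (σ : Equiv.Perm (Fin m)) : Finset ℕ :=
  (descents σ).image fun d => letter σ d.2

/-- The number of pairs `(i, j)` with `2 ≤ i < j ≤ m` and `σ_{i-1} > σ_j > σ_i`.
Such an `i` is the second position of a descent, so the pair `(i, j)` is recorded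
as the descent `d = (i - 1, i)` together with `j`. -/
def les {m : ℕ} (σ : Equiv.Perm (Fin m)) : ℕ :=
  ((descents σ ×ˢ (Finset.univ : Finset (Fin m))).filter fun e =>
    e.1.2 < e.2 ∧ letter σ e.1.2 < letter σ e.2 ∧ letter σ e.2 < letter σ e.1.1).card

/-- The number of pairs `(i, j)` with `1 ≤ i < j ≤ m - 1` and `σ_j > σ_i > σ_{j+1}`.
Such a `j` is the first position of a descent, so the pair `(i, j)` is recorded
as the descent `d = (j, j + 1)` together with `i`. -/
def res {m : ℕ} (σ : Equiv.Perm (Fin m)) : ℕ :=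
  ((descents σ ×ˢ (Finset.univ : Finset (Fin m))).filter fun e =>
    e.2 < e.1.1 ∧ letter σ e.1.2 < letter σ e.2 ∧ letter σ e.2 < letter σ e.1.1).card

/-- The number `l_σ(x)` of left-embracings of the letter `x`: descents `(σ_{i-1}, σ_i)` to the
left of `x` with `σ_{i-1} > x > σ_i`. -/
def leftEmb {m : ℕ} (σ : Equiv.Perm (Fin m)) (x : ℕ) : ℕ :=
  ((descents σ).filter fun d =>
    (∃ j : Fin m, letter σ j = x ∧ d.2 < j) ∧ letter σ d.2 < x ∧ x < letter σ d.1).card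

/-- The number `r_σ(x)` of right-embracings of the letter `x`: descents `(σ_j, σ_{j+1})` to the
right of `x` with `σ_j > x > σ_{j+1}`. -/
def rightEmb {m : ℕ} (σ : Equiv.Perm (Fin m)) (x : ℕ) : ℕ :=
  ((descents σ).filter fun d =>
    (∃ i : Fin m, letter σ i = x ∧ i < d.1) ∧ letter σ d.2 < x ∧ x < letter σ d.1).card

/-- The set `S_σ` of descent tops and descent bottoms. -/
def sigSet {m : ℕ} (σ : Equiv.Perm (Fin m)) : Finset ℕ := descentTops σ ∪ descentBottoms σ

/-- The signature function `s_σ(x) = S_o(x) - S_e(x) + (1 if x ∈ S_o or x ∉ S)`, where `S_o(x)`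
and `S_e(x)` count the odd and the even elements of `S = S_σ` that are less than `x`. -/
def sig {m : ℕ} (σ : Equiv.Perm (Fin m)) (x : ℕ) : ℤ :=
  (((sigSet σ).filter fun y => Odd y ∧ y < x).card : ℤ)
    - (((sigSet σ).filter fun y => Even y ∧ y < x).card : ℤ)
    + if (x ∈ sigSet σ ∧ Odd x) ∨ x ∉ sigSet σ then 1 else 0

/-- Every descent of `σ` is even-odd: its top is even and its bottom is odd. -/
def IsEvenOddDescent {m : ℕ} (σ : Equiv.Perm (Fin m)) : Prop :=
  ∀ d ∈ descents σ, Even (letter σ d.1) ∧ Odd (letter σ d.2)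

/-- `E`-permutations of `[2n]`: even-odd descent permutations such that for no `j ∈ [n]` the
letters `2j - 1` and `2j` are simultaneously a descent bottom and a descent top. -/
def IsEPerm {n : ℕ} (σ : Equiv.Perm (Fin (2 * n))) : Prop :=
  IsEvenOddDescent σ ∧
    ∀ j ∈ Finset.Icc 1 n, ¬ (2 * j - 1 ∈ descentBottoms σ ∧ 2 * j ∈ descentTops σ)

/-- Normalized `E`-permutations of `[2n]`. -/
def IsNormalizedEPerm {n : ℕ} (σ : Equiv.Perm (Fin (2 * n))) : Prop :=
  IsEPerm σ ∧ ∀ j ∈ Finset.Icc 1 n,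
    (2 * j - 1 ∈ sigSet σ ∧ Odd (sig σ (2 * j - 1)) → Even (leftEmb σ (2 * j))) ∧
    (2 * j - 1 ∈ sigSet σ ∧ Even (sig σ (2 * j - 1)) → Even (leftEmb σ (2 * j - 1))) ∧
    (2 * j ∈ sigSet σ ∧ Odd (sig σ (2 * j)) → Even (rightEmb σ (2 * j - 1))) ∧
    (2 * j ∈ sigSet σ ∧ Even (sig σ (2 * j)) → Even (rightEmb σ (2 * j)))

instance {m : ℕ} : DecidablePred (IsEvenOddDescent (m := m)) := fun σ => by
  unfold IsEvenOddDescent; infer_instance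

instance {n : ℕ} : DecidablePred (IsEPerm (n := n)) := fun σ => by
  unfold IsEPerm; infer_instance

instance {n : ℕ} : DecidablePred (IsNormalizedEPerm (n := n)) := fun σ => by
  unfold IsNormalizedEPerm; infer_instance

/-- The even-odd descent permutations of `[2n]`. -/
def evenOddPerms (n : ℕ) : Finset (Equiv.Perm (Fin (2 * n))) :=
  Finset.univ.filter fun σ => IsEvenOddDescent σ

/-- The `E`-permutations of `[2n]` with `k` descents. -/
def ePerms (n k : ℕ) : Finset (Equiv.Perm (Fin (2 * n))) :=
  Finset.univ.filter fun σ => IsEPerm σ ∧ des σ = k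

/-- The normalized `E`-permutations of `[2n]` with `k` descents. -/
def normalizedEPerms (n k : ℕ) : Finset (Equiv.Perm (Fin (2 * n))) :=
  Finset.univ.filter fun σ => IsNormalizedEPerm σ ∧ des σ = k

/-- The `(p,q)`-descent polynomial `X_n(p,q,t)`, evaluated in a commutative ring. -/
def descentPoly {R : Type*} [CommRing R] (n : ℕ) (p q t : R) : R :=
  ∑ σ ∈ evenOddPerms n, p ^ res σ * q ^ les σ * t ^ des σ

/-- The coefficient `γ_{n,k}(p,q)`, evaluated in a commutative ring. -/
def gammaCoeff {R : Type*} [CommRing R] (n k : ℕ) (p q : R) : R :=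
  ∑ σ ∈ ePerms n k, p ^ res σ * q ^ les σ

/-! Read the letters of a permutation in increasing order. Recording for each letter whether it is a
descent top, whether it is a descent bottom, and its number of left-embracings gives a Laguerre-type
history, whose height counts the open descents. The history determines the permutation
(`eq_of_leftEmb_eq`). There are exactly `m!` histories from height 0 to height 0 (`card_histories`),
so the encoding is a bijection onto histories. Both embracing numbers can be read off each step, so
`les`, `res` and `des` become additive statistics of histories.

Pair the letters `2j - 1, 2j`. Write `[h]` for `pqNumber p q h`. For even-odd descents a pair of
steps at height `h` is neutral with weight `[h+1]^2`, bottom-top with weight `t [h+1]^2`, up with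
weight `t [h+1][h+2]`, or down with weight `[h+1][h]`. Bottom-top pairs also preserve the height,
and are exactly what an `E`-permutation forbids. Absorbing them into the neutral pairs, now weighted
by `1 + t`, gives the gamma expansion, since an `E`-permutation with `k` descents has `n - 2k`
neutral pairs.

In an up or down pair one of the two consecutive factors has even index, and `[2k]` is `p + q` times
a sum of monomials with even exponents (`pqNumber_two_mul`). Normalization keeps one representative
from each resulting couple of choices. It therefore removes a factor `p + q` from every up and every
down pair, and the spare `p` (up) or `q` (down) accounts for the shift by `k`. Conjugating by `(p +
q)^h` collects these factors (`pairSum_eWeight_eq_normalizedWeight`). Taking coefficients in `t`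
finishes the proof. -/

section

open Finset

/-! ### Open descents, embracings and the statistics as sums over letters. -/

section Words

variable {m : ℕ} (σ : Equiv.Perm (Fin m))

theorem mem_descents {d : Fin m × Fin m} :
    d ∈ descents σ ↔ (d.1 : ℕ) + 1 = d.2 ∧ letter σ d.2 < letter σ d.1 := by
  simp [descents]

theorem letter_injective : Function.Injective (letter σ) := by
  intro i j h
  simpa [letter, Fin.val_inj] using h

theorem exists_letter_eq {x : ℕ} (hx : x < m) : ∃ j : Fin m, letter σ j = x + 1 :=
  ⟨σ.symm ⟨x, hx⟩, by simp [letter]⟩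

theorem letter_le (i : Fin m) : letter σ i ≤ m := (σ i).isLt

theorem one_le_letter (i : Fin m) : 1 ≤ letter σ i := Nat.le_add_left _ _

theorem descents_eq_of_fst_eq {d e : Fin m × Fin m} (hd : d ∈ descents σ)
    (he : e ∈ descents σ) (h : d.1 = e.1) : d = e := by
  rw [mem_descents] at hd he
  refine Prod.ext h (Fin.ext ?_)
  have := congrArg Fin.val h
  omega

theorem descents_eq_of_snd_eq {d e : Fin m × Fin m} (hd : d ∈ descents σ)
    (he : e ∈ descents σ) (h : d.2 = e.2) : d = e := by
  rw [mem_descents] at hd he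
  refine Prod.ext (Fin.ext ?_) h
  have := congrArg Fin.val h
  omega

/-- The descents `(σ_i, σ_{i+1})` with `σ_i > x ≥ σ_{i+1}`. -/
def openDescents (x : ℕ) : Finset (Fin m × Fin m) :=
  (descents σ).filter fun d => letter σ d.2 ≤ x ∧ x < letter σ d.1

/-- The number of descents that are open after the letters `1, …, x`. -/
def height (x : ℕ) : ℕ := (openDescents σ x).card

/-- The descents that strictly embrace the letter `x`. -/
def embracing (x : ℕ) : Finset (Fin m × Fin m) :=
  (descents σ).filter fun d => letter σ d.2 < x ∧ x < letter σ d.1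

theorem card_filter_top (x : ℕ) :
    ((descents σ).filter fun d => letter σ d.1 = x).card
      = if x ∈ descentTops σ then 1 else 0 := by
  split_ifs with h
  · obtain ⟨d, hd, hx⟩ := mem_image.1 h
    refine card_eq_one.2 ⟨d, ?_⟩
    ext e
    simp only [mem_filter, mem_singleton]
    refine ⟨fun he => descents_eq_of_fst_eq σ he.1 hd (letter_injective σ (he.2.trans hx.symm)), ?_⟩
    rintro rfl
    exact ⟨hd, hx⟩
  · refine card_eq_zero.2 (filter_eq_empty_iff.2 fun d hd hx => h ?_)
    exact mem_image.2 ⟨d, hd, hx⟩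

theorem card_filter_bottom (x : ℕ) :
    ((descents σ).filter fun d => letter σ d.2 = x).card
      = if x ∈ descentBottoms σ then 1 else 0 := by
  split_ifs with h
  · obtain ⟨d, hd, hx⟩ := mem_image.1 h
    refine card_eq_one.2 ⟨d, ?_⟩
    ext e
    simp only [mem_filter, mem_singleton]
    refine ⟨fun he => descents_eq_of_snd_eq σ he.1 hd (letter_injective σ (he.2.trans hx.symm)), ?_⟩
    rintro rfl
    exact ⟨hd, hx⟩
  · refine card_eq_zero.2 (filter_eq_empty_iff.2 fun d hd hx => h ?_)
    exact mem_image.2 ⟨d, hd, hx⟩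

/-- A descent open after `x` either strictly embraces `x + 1` or is closed by it, and a letter tops
at most one descent. -/
theorem height_eq_embracing_add_top (x : ℕ) :
    height σ x = (embracing σ (x + 1)).card + if x + 1 ∈ descentTops σ then 1 else 0 := by
  rw [← card_filter_top, height, ← card_union_of_disjoint]
  · congr 1
    ext d
    simp only [openDescents, embracing, mem_union, mem_filter]
    have : d ∈ descents σ → letter σ d.2 < letter σ d.1 := fun h => ((mem_descents σ).1 h).2
    grind
  · refine disjoint_left.2 fun d hd he => ?_
    simp only [embracing, mem_filter] at hd he
    omega

theorem height_succ_eq_embracing_add_bottom (x : ℕ) :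
    height σ (x + 1) =
      (embracing σ (x + 1)).card + if x + 1 ∈ descentBottoms σ then 1 else 0 := by
  rw [← card_filter_bottom, height, ← card_union_of_disjoint]
  · congr 1
    ext d
    simp only [openDescents, embracing, mem_union, mem_filter]
    have : d ∈ descents σ → letter σ d.2 < letter σ d.1 := fun h => ((mem_descents σ).1 h).2
    grind
  · refine disjoint_left.2 fun d hd he => ?_
    simp only [embracing, mem_filter] at hd he
    omega

theorem height_zero : height σ 0 = 0 := by
  refine card_eq_zero.2 (filter_eq_empty_iff.2 fun d _ h => ?_)
  have := one_le_letter σ d.2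
  omega

theorem height_self : height σ m = 0 := by
  refine card_eq_zero.2 (filter_eq_empty_iff.2 fun d _ h => ?_)
  have := letter_le σ d.1
  omega

theorem leftEmb_letter (j : Fin m) : leftEmb σ (letter σ j) =
    ((embracing σ (letter σ j)).filter fun d => d.2 < j).card := by
  unfold leftEmb embracing
  rw [filter_filter]
  congr 1
  refine filter_congr fun d _ => ?_
  constructor
  · rintro ⟨⟨i, hi, h⟩, h'⟩
    exact ⟨h', letter_injective σ hi ▸ h⟩
  · rintro ⟨h', h⟩
    exact ⟨⟨j, rfl, h⟩, h'⟩

theorem rightEmb_letter (j : Fin m) : rightEmb σ (letter σ j) =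
    ((embracing σ (letter σ j)).filter fun d => j < d.1).card := by
  unfold rightEmb embracing
  rw [filter_filter]
  congr 1
  refine filter_congr fun d _ => ?_
  constructor
  · rintro ⟨⟨i, hi, h⟩, h'⟩
    exact ⟨h', letter_injective σ hi ▸ h⟩
  · rintro ⟨h', h⟩
    exact ⟨⟨j, rfl, h⟩, h'⟩

/-- A strictly embracing descent does not use the letter itself, and its two positions are adjacent,
so it lies wholly on one side. Hence right-embracings need not be recorded separately. -/
theorem leftEmb_add_rightEmb {x : ℕ} (hx : x < m) :
    leftEmb σ (x + 1) + rightEmb σ (x + 1) = (embracing σ (x + 1)).card := by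
  obtain ⟨j, hj⟩ := exists_letter_eq σ hx
  rw [← hj, leftEmb_letter, rightEmb_letter,
    ← card_filter_add_card_filter_not (s := embracing σ (letter σ j)) (fun d => d.2 < j)]
  congr 2
  refine filter_congr fun d hd => ?_
  simp only [embracing, mem_filter, mem_descents] at hd
  have h1 : d.1 ≠ j := by rintro rfl; omega
  have h2 : d.2 ≠ j := by rintro rfl; omega
  have h1' := Fin.val_ne_of_ne h1
  have h2' := Fin.val_ne_of_ne h2
  rw [Fin.lt_def, Fin.lt_def]
  omega

/-- Double counting, with positions reindexed by their letters; it serves both `les` and `res`. -/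
theorem sum_range_card_filter_letter (P : Fin m × Fin m → Fin m → Prop) [∀ d, DecidablePred (P d)]
    (Q : ℕ → Fin m × Fin m → Prop) [∀ x, DecidablePred (Q x)]
    (h : ∀ d j, Q (letter σ j) d ↔ P d j) :
    ((descents σ ×ˢ (univ : Finset (Fin m))).filter fun e => P e.1 e.2).card
      = ∑ x ∈ range m, ((descents σ).filter (Q (x + 1))).card := by
  rw [← Fin.sum_univ_eq_sum_range fun x => ((descents σ).filter (Q (x + 1))).card,
    ← Equiv.sum_comp σ, card_filter, sum_product_right]
  refine sum_congr rfl fun j _ => ?_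
  rw [card_filter]
  refine sum_congr rfl fun d _ => ?_
  simp only [← h, letter]

theorem les_eq_sum : les σ = ∑ x ∈ range m, leftEmb σ (x + 1) := by
  refine sum_range_card_filter_letter σ
    (fun d j => d.2 < j ∧ letter σ d.2 < letter σ j ∧ letter σ j < letter σ d.1)
    (fun x d => (∃ j : Fin m, letter σ j = x ∧ d.2 < j) ∧ letter σ d.2 < x ∧ x < letter σ d.1)
    fun d j => ⟨?_, fun h => ⟨⟨j, rfl, h.1⟩, h.2⟩⟩
  rintro ⟨⟨i, hi, h⟩, h'⟩
  exact ⟨letter_injective σ hi ▸ h, h'⟩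

theorem res_eq_sum : res σ = ∑ x ∈ range m, rightEmb σ (x + 1) := by
  refine sum_range_card_filter_letter σ
    (fun d j => j < d.1 ∧ letter σ d.2 < letter σ j ∧ letter σ j < letter σ d.1)
    (fun x d => (∃ j : Fin m, letter σ j = x ∧ j < d.1) ∧ letter σ d.2 < x ∧ x < letter σ d.1)
    fun d j => ⟨?_, fun h => ⟨⟨j, rfl, h.1⟩, h.2⟩⟩
  rintro ⟨⟨i, hi, h⟩, h'⟩
  exact ⟨letter_injective σ hi ▸ h, h'⟩

theorem card_filter_letter_lt_eq_sum (f : Fin m × Fin m → Fin m) (k : ℕ) :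
    ((descents σ).filter fun d => letter σ (f d) ≤ k).card
      = ∑ x ∈ range k, ((descents σ).filter fun d => letter σ (f d) = x + 1).card := by
  induction k with
  | zero =>
    refine card_eq_zero.2 (filter_eq_empty_iff.2 fun d _ h => ?_)
    have := one_le_letter σ (f d)
    omega
  | succ k ih =>
    rw [sum_range_succ, ← ih, ← card_union_of_disjoint]
    · congr 1
      ext d
      simp only [mem_union, mem_filter]
      rw [← and_or_left, Nat.le_succ_iff]
    · refine disjoint_left.2 fun d hd he => ?_
      simp only [mem_filter] at hd he
      omega

theorem des_eq_sum_tops :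
    des σ = ∑ x ∈ range m, if x + 1 ∈ descentTops σ then 1 else 0 := by
  simp only [← card_filter_top]
  rw [← card_filter_letter_lt_eq_sum σ Prod.fst, filter_true_of_mem fun d _ => letter_le σ d.1]
  rfl

theorem des_eq_sum_bottoms :
    des σ = ∑ x ∈ range m, if x + 1 ∈ descentBottoms σ then 1 else 0 := by
  simp only [← card_filter_bottom]
  rw [← card_filter_letter_lt_eq_sum σ Prod.snd, filter_true_of_mem fun d _ => letter_le σ d.2]
  rfl

end Words

/-! ### Reconstruction of a permutation by inserting its letters in increasing order. -/

section Injectivity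

variable {m : ℕ} (σ : Equiv.Perm (Fin m))

/-- The letter `b + 1` is at most `x` and is preceded by a letter greater than `x`. -/
def IsStart (x : ℕ) (b : Fin m) : Prop :=
  letter σ (σ.symm b) ≤ x ∧ ∃ d ∈ descents σ, σ d.2 = b ∧ x < letter σ d.1

theorem leftEmb_eq_card_starts (x : Fin m) [DecidablePred (IsStart σ x)] :
    leftEmb σ (x + 1) =
      (univ.filter fun b => IsStart σ x b ∧ σ.symm b < σ.symm x).card := by
  have hl : letter σ (σ.symm x) = x + 1 := by simp [letter]
  rw [← hl, leftEmb_letter]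
  refine card_bij (fun d _ => σ d.2) ?_ ?_ ?_
  · intro d hd
    simp only [embracing, mem_filter] at hd
    rw [mem_filter, IsStart, Equiv.symm_apply_apply]
    exact ⟨mem_univ _, ⟨by omega, d, hd.1.1, rfl, by omega⟩, hd.2⟩
  · intro d hd e he h
    simp only [embracing, mem_filter] at hd he
    exact descents_eq_of_snd_eq σ hd.1.1 he.1.1 (σ.injective h)
  · intro b hb
    rw [mem_filter] at hb
    obtain ⟨-, ⟨h1, d, hd, rfl, h2⟩, h3⟩ := hb
    rw [Equiv.symm_apply_apply] at h1 h3
    refine ⟨d, ?_, rfl⟩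
    simp only [embracing, mem_filter]
    have hd' := (mem_descents σ).1 hd
    -- If the top were `x + 1` itself, the bottom would stand right after it, not before it.
    refine ⟨⟨hd, by omega, lt_of_le_of_ne (by omega) fun h => ?_⟩, h3⟩
    have := letter_injective σ h
    rw [Fin.lt_def] at h3
    have := congrArg Fin.val this
    omega

/-- Between the letter `x + 1` and a later smaller letter a block of letters at most `x` starts. -/
theorem exists_start_between {x a : Fin m} (hax : a < x) (h : σ.symm x < σ.symm a) :
    ∃ b, IsStart σ x b ∧ σ.symm x < σ.symm b ∧ σ.symm b ≤ σ.symm a := by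
  classical
  -- The start sought is the leftmost position after `x` from which all values up to `a` stay below
  -- `x`; by minimality the value just before it is at least `x`.
  have key : ∃ k : ℕ, ∃ i : Fin m, (i : ℕ) = k ∧ σ.symm x < i ∧ i ≤ σ.symm a ∧
      ∀ j, i ≤ j → j ≤ σ.symm a → σ j < x :=
    ⟨_, σ.symm a, rfl, h, le_rfl, fun j h1 h2 => by
      rw [le_antisymm h2 h1, Equiv.apply_symm_apply]; exact hax⟩
  obtain ⟨i, hi, h1, h2, h3⟩ := Nat.find_spec key
  have hmin := fun k => Nat.find_min key (m := k)
  rw [← hi] at hmin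
  have hi0 : 0 < (i : ℕ) := lt_of_le_of_lt (Nat.zero_le _) (Fin.lt_def.1 h1)
  let i' : Fin m := ⟨i - 1, by omega⟩
  have hi' : (i' : ℕ) + 1 = i := Nat.sub_add_cancel hi0
  have hσi : σ i < x := h3 i le_rfl h2
  have hσi' : x ≤ σ i' := by
    by_contra hlt
    rw [not_le] at hlt
    refine hmin (i' : ℕ) (by omega) ⟨i', rfl, lt_of_le_of_ne ?_ ?_, ?_, ?_⟩
    · rw [Fin.le_def]; rw [Fin.lt_def] at h1; omega
    · intro he
      rw [← he, Equiv.apply_symm_apply] at hlt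
      exact lt_irrefl _ hlt
    · rw [Fin.le_def] at h2 ⊢; omega
    · intro j hj1 hj2
      by_cases hj : i' = j
      · rw [← hj]; exact hlt
      · refine h3 j ?_ hj2
        rw [Fin.le_def] at hj1 ⊢
        have := Fin.val_ne_of_ne hj
        omega
  have hσ : σ i < σ i' := lt_of_lt_of_le hσi hσi'
  refine ⟨σ i, ⟨?_, (i', i), ?_, rfl, ?_⟩, by simpa using h1, by simpa using h2⟩
  · simp only [Equiv.symm_apply_apply, letter]; exact hσi
  · rw [mem_descents]; exact ⟨hi', by simpa [letter] using hσ⟩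
  · simp only [letter]; exact Nat.lt_succ_of_le hσi'

/-- The left-embracings of `x + 1` count the starts before it, so comparing with the starts up to
`a` locates the new letter among the smaller ones. -/
theorem symm_lt_symm_iff_leftEmb_lt {x a : Fin m} (hax : a < x) [DecidablePred (IsStart σ x)] :
    σ.symm x < σ.symm a ↔ leftEmb σ (x + 1) <
      (univ.filter fun b => IsStart σ x b ∧ σ.symm b ≤ σ.symm a).card := by
  rw [leftEmb_eq_card_starts]
  constructor
  · intro h
    obtain ⟨b, hb, h1, h2⟩ := exists_start_between σ hax h
    refine card_lt_card (ssubset_iff_of_subset ?_ |>.2 ⟨b, ?_, ?_⟩)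
    · intro c hc
      simp only [mem_filter, mem_univ, true_and] at hc ⊢
      exact ⟨hc.1, (hc.2.trans h).le⟩
    · simp [hb, h2]
    · simp [h1.le]
  · contrapose!
    intro h
    have hne : σ.symm a ≠ σ.symm x := fun he => hax.ne (σ.symm.injective he)
    refine card_le_card fun c hc => ?_
    simp only [mem_filter, mem_univ, true_and] at hc ⊢
    exact ⟨hc.1, hc.2.trans_lt (lt_of_le_of_ne h hne)⟩

/-- Inserting `x + 1` as a top glues it to the next start on its right, which ceases to be one;
inserting it as a bottom makes it a new start. -/
theorem isStart_succ_iff (x b : Fin m) : IsStart σ (x + 1) b ↔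
    (IsStart σ x b ∧ ¬ ((x : ℕ) + 1 ∈ descentTops σ ∧ σ.symm x < σ.symm b ∧
      ∀ c, IsStart σ x c → σ.symm x < σ.symm c → σ.symm b ≤ σ.symm c)) ∨
    (b = x ∧ (x : ℕ) + 1 ∈ descentBottoms σ) := by
  have hl : ∀ i, letter σ i = x + 1 ↔ σ i = x := fun i => by
    simp [letter, Fin.ext_iff]
  constructor
  · rintro ⟨h1, d, hd, rfl, h2⟩
    rw [Equiv.symm_apply_apply] at h1
    by_cases hb : σ d.2 = x
    · exact Or.inr ⟨hb, mem_image.2 ⟨d, hd, (hl _).2 hb⟩⟩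
    · left
      have hne := mt (hl d.2).1 hb
      refine ⟨⟨by rw [Equiv.symm_apply_apply]; omega, d, hd, rfl, by omega⟩, ?_⟩
      rintro ⟨ht, h3, h4⟩
      obtain ⟨e, he, hex⟩ := mem_image.1 ht
      have he' := (mem_descents σ).1 he
      have hd' := (mem_descents σ).1 hd
      have hx := (hl _).1 hex
      have hxs : σ.symm x = e.1 := by rw [← hx, Equiv.symm_apply_apply]
      have := h4 (σ e.2) ⟨by rw [Equiv.symm_apply_apply]; omega, e, he, rfl, by omega⟩
        (by rw [Equiv.symm_apply_apply, hxs, Fin.lt_def]; omega)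
      rw [Equiv.symm_apply_apply, Equiv.symm_apply_apply, Fin.le_def] at this
      rw [hxs, Equiv.symm_apply_apply, Fin.lt_def] at h3
      have hde : d = e := descents_eq_of_snd_eq σ hd he (Fin.ext (by omega))
      rw [hde] at h2
      omega
  · rintro (⟨⟨h1, d, hd, rfl, h2⟩, h3⟩ | ⟨rfl, hb⟩)
    · refine ⟨by omega, d, hd, rfl, lt_of_le_of_ne h2 fun hdx => h3 ?_⟩
      have hd' := (mem_descents σ).1 hd
      have hx := (hl _).1 hdx.symm
      have hxs : σ.symm x = d.1 := by rw [← hx, Equiv.symm_apply_apply]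
      refine ⟨mem_image.2 ⟨d, hd, hdx.symm⟩, ?_, fun c _ hc => ?_⟩
      · rw [hxs, Equiv.symm_apply_apply, Fin.lt_def]; omega
      · rw [hxs, Fin.lt_def] at hc
        rw [Equiv.symm_apply_apply, Fin.le_def]; omega
    · obtain ⟨d, hd, hdx⟩ := mem_image.1 hb
      have hd' := (mem_descents σ).1 hd
      refine ⟨by simp [letter], d, hd, (hl _).1 hdx, by omega⟩

/-- A permutation is determined by its descent tops, its descent bottoms and the numbers of
left-embracings of its letters. -/
theorem eq_of_leftEmb_eq {σ τ : Equiv.Perm (Fin m)}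
    (ht : ∀ x < m, x + 1 ∈ descentTops σ ↔ x + 1 ∈ descentTops τ)
    (hb : ∀ x < m, x + 1 ∈ descentBottoms σ ↔ x + 1 ∈ descentBottoms τ)
    (hl : ∀ x < m, leftEmb σ (x + 1) = leftEmb τ (x + 1)) : σ = τ := by
  classical
  -- The starts must be carried along with the relative order: together they determine where the
  -- next letter goes.
  have key : ∀ k ≤ m,
      (∀ a b : Fin m, (a : ℕ) < k → (b : ℕ) < k →
        (σ.symm a < σ.symm b ↔ τ.symm a < τ.symm b)) ∧
      ∀ b, IsStart σ k b ↔ IsStart τ k b := by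
    intro k
    induction k with
    | zero =>
      refine fun _ => ⟨fun a b h => absurd h (Nat.not_lt_zero _), fun b => ?_⟩
      refine iff_of_false (fun h => ?_) (fun h => ?_)
      · have := one_le_letter σ (σ.symm b); have := h.1; omega
      · have := one_le_letter τ (τ.symm b); have := h.1; omega
    | succ k ih =>
      intro hk
      obtain ⟨ih1, ih2⟩ := ih (by omega)
      let x : Fin m := ⟨k, by omega⟩
      have hstart : ∀ {ρ : Equiv.Perm (Fin m)} {b}, IsStart ρ k b → (b : ℕ) < k := by
        intro ρ b h
        have := h.1
        simp only [letter, Equiv.apply_symm_apply] at this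
        omega
      have hle : ∀ a b : Fin m, (a : ℕ) < k → (b : ℕ) < k →
          (σ.symm a ≤ σ.symm b ↔ τ.symm a ≤ τ.symm b) := fun a b h1 h2 => by
        rw [← not_lt, ← not_lt, ih1 b a h2 h1]
      have hx : ∀ a : Fin m, (a : ℕ) < k →
          (σ.symm x < σ.symm a ↔ τ.symm x < τ.symm a) := by
        intro a ha
        rw [symm_lt_symm_iff_leftEmb_lt σ (x := x) ha, symm_lt_symm_iff_leftEmb_lt τ (x := x) ha,
          hl x x.isLt]
        have : (univ.filter fun b => IsStart σ x b ∧ σ.symm b ≤ σ.symm a)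
            = univ.filter fun b => IsStart τ x b ∧ τ.symm b ≤ τ.symm a := by
          refine filter_congr fun b _ => ?_
          rw [show IsStart σ x b ↔ IsStart τ x b from ih2 b]
          exact and_congr_right fun h => hle b a (hstart h) ha
        rw [this]
      have hx' : ∀ a : Fin m, (a : ℕ) < k →
          (σ.symm a < σ.symm x ↔ τ.symm a < τ.symm x) := by
        intro a ha
        have hne : ∀ ρ : Equiv.Perm (Fin m), ρ.symm x ≠ ρ.symm a := fun ρ h => by
          have := congrArg Fin.val (ρ.symm.injective h)
          simp only [x] at this
          omega
        have h := not_congr (hx a ha)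
        rw [not_lt, not_lt] at h
        exact ⟨fun h1 => lt_of_le_of_ne (h.1 h1.le) (hne τ).symm,
          fun h1 => lt_of_le_of_ne (h.2 h1.le) (hne σ).symm⟩
      refine ⟨fun a b ha hb' => ?_, fun b => ?_⟩
      · rcases Nat.lt_succ_iff_lt_or_eq.1 ha with ha | ha <;>
          rcases Nat.lt_succ_iff_lt_or_eq.1 hb' with hb' | hb'
        · exact ih1 a b ha hb'
        · rw [show b = x from Fin.ext hb']; exact hx' a ha
        · rw [show a = x from Fin.ext ha]; exact hx b hb'
        · rw [show a = b from Fin.ext (ha.trans hb'.symm)]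
          simp
      · have h1 := isStart_succ_iff σ x b
        have h2 := isStart_succ_iff τ x b
        simp only [x] at h1 h2
        rw [h1, h2, ih2 b, ht k (by omega), hb k (by omega)]
        refine or_congr_left (and_congr_right fun hs => not_congr (and_congr_right fun _ => ?_))
        refine and_congr (hx b (hstart hs)) (forall_congr' fun c => ?_)
        rw [ih2 c]
        exact forall_congr' fun hc => imp_congr (hx c (hstart hc)) (hle b c (hstart hs) (hstart hc))
  have hlt : ∀ a b : Fin m, σ.symm a < σ.symm b ↔ τ.symm a < τ.symm b :=
    fun a b => (key m le_rfl).1 a b a.isLt b.isLt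
  have hmono : StrictMono fun i => τ.symm (σ i) := fun i j hij => by
    have := (hlt (σ i) (σ j)).1 (by simpa using hij)
    exact this
  have hid : ∀ i, τ.symm (σ i) = i := by
    -- A finite chain has no order automorphism but the identity.
    let e : Fin m ≃o Fin m := hmono.orderIsoOfSurjective _ (τ.symm.surjective.comp σ.surjective)
    have : e = OrderIso.refl _ := Subsingleton.elim _ _
    intro i
    exact congrArg (fun f : Fin m ≃o Fin m => f i) this
  ext i
  rw [← τ.apply_symm_apply (σ i), hid]

end Injectivity

/-! ### Histories and their bijection with permutations. -/

section Histories

/-- A step `(top, bottom, l)` of a history: whether the letter is a descent top, whether it is a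
descent bottom, and its number of left-embracings. -/
abbrev HistoryStep : Type := Bool × Bool × ℕ

/-- The steps that may start at height `h`. -/
def allowedSteps (h : ℕ) : Finset HistoryStep :=
  (univ ×ˢ univ ×ˢ range (h + 1)).filter fun s => s.2.2 + s.1.toNat ≤ h

/-- The height after the step `s` from height `h`. -/
def nextHeight (h : ℕ) (s : HistoryStep) : ℕ := h + s.2.1.toNat - s.1.toNat

theorem mem_allowedSteps {h : ℕ} {s : HistoryStep} :
    s ∈ allowedSteps h ↔ s.2.2 + s.1.toNat ≤ h := by
  simp only [allowedSteps, mem_filter, mem_product, mem_univ, true_and, mem_range]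
  omega

/-- A top closes one of the `h` open descents, leaving `h` values of `l` instead of `h + 1`. -/
theorem sum_allowedSteps {M : Type*} [AddCommMonoid M] (h : ℕ) (f : HistoryStep → M) :
    ∑ s ∈ allowedSteps h, f s =
      ∑ l ∈ range (h + 1), f (false, false, l) + ∑ l ∈ range (h + 1), f (false, true, l) +
      (∑ l ∈ range h, f (true, false, l) + ∑ l ∈ range h, f (true, true, l)) := by
  have h1 : ∀ b, ∑ l ∈ range (h + 1), (if l + 1 ≤ h then f (true, b, l) else 0)
      = ∑ l ∈ range h, f (true, b, l) := fun b => by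
    rw [sum_range_succ, if_neg (by omega), add_zero]
    exact sum_congr rfl fun l hl => if_pos (mem_range.1 hl)
  have h2 : ∀ b, ∑ l ∈ range (h + 1), (if l ≤ h then f (false, b, l) else 0)
      = ∑ l ∈ range (h + 1), f (false, b, l) := fun b =>
    sum_congr rfl fun l hl => if_pos (Nat.lt_succ_iff.1 (mem_range.1 hl))
  rw [allowedSteps, sum_filter, sum_product, Fintype.sum_bool, sum_product, sum_product,
    Fintype.sum_bool, Fintype.sum_bool]
  simp only [Bool.toNat_true, Bool.toNat_false, add_zero, h1, h2]
  abel

/-- The histories with `m` steps from height `h` to height `0`. -/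
def histories : ℕ → ℕ → Finset (List HistoryStep)
  | 0, h => if h = 0 then {[]} else ∅
  | m + 1, h => (allowedSteps h).biUnion fun s => (histories m (nextHeight h s)).image (s :: ·)

theorem sum_histories_succ {M : Type*} [AddCommMonoid M] (m h : ℕ) (f : List HistoryStep → M) :
    ∑ w ∈ histories (m + 1) h, f w =
      ∑ s ∈ allowedSteps h, ∑ w ∈ histories m (nextHeight h s), f (s :: w) := by
  rw [histories, sum_biUnion]
  · exact sum_congr rfl fun s _ => sum_image fun a _ b _ hab => (List.cons.inj hab).2
  · intro s _ s' _ hs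
    refine disjoint_left.2 fun w hw hw' => hs ?_
    obtain ⟨a, -, rfl⟩ := mem_image.1 hw
    obtain ⟨b, -, hb⟩ := mem_image.1 hw'
    exact (List.cons.inj hb).1.symm

/-- The general height `h` is needed for the induction; only `h = 0` is used later. The recursion
reduces to Pascal's rule and the ratio of neighbouring binomial coefficients. -/
theorem card_histories (m h : ℕ) : (histories m h).card = m.factorial * m.choose h := by
  induction m generalizing h with
  | zero =>
    rcases h with _ | h <;> simp [histories]
  | succ m ih =>
    rw [card_eq_sum_ones, sum_histories_succ]
    simp only [← card_eq_sum_ones, ih]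
    rw [sum_allowedSteps]
    simp only [nextHeight, Bool.toNat_true, Bool.toNat_false, sum_const, card_range, smul_eq_mul,
      add_zero, Nat.sub_zero, Nat.add_sub_cancel]
    rcases h with _ | h
    · simp only [Nat.choose_zero_right, Nat.factorial_succ, zero_add, Nat.choose_one_right]
      ring
    · have h1 := Nat.choose_succ_right_eq m (h + 1)
      have h2 := Nat.choose_succ_right_eq m h
      rw [Nat.add_sub_cancel, Nat.factorial_succ, Nat.choose_succ_succ]
      rcases le_or_gt (h + 1) m with hm | hm
      · obtain ⟨d, rfl⟩ := Nat.exists_eq_add_of_le hm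
        rw [show h + 1 + d - (h + 1) = d by omega] at h1
        rw [show h + 1 + d - h = d + 1 by omega] at h2
        generalize (h + 1 + d).choose (h + 1 + 1) = a at *
        generalize (h + 1 + d).choose (h + 1) = b at *
        generalize (h + 1 + d).choose h = c at *
        zify at h1 h2 ⊢
        linear_combination ((h + 1 + d).factorial : ℤ) * h1 + ((h + 1 + d).factorial : ℤ) * h2
      · rw [Nat.choose_eq_zero_of_lt hm, Nat.choose_eq_zero_of_lt (by omega : m < h + 1 + 1)] at *
        rcases eq_or_ne h m with rfl | hne
        · ring
        · rw [Nat.choose_eq_zero_of_lt (by omega : m < h)]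
          ring

variable {m : ℕ} (σ : Equiv.Perm (Fin m))

/-- The step of the history of `σ` at the letter `x + 1`. -/
def historyStep (x : ℕ) : HistoryStep :=
  (decide (x + 1 ∈ descentTops σ), decide (x + 1 ∈ descentBottoms σ), leftEmb σ (x + 1))

/-- The history of `σ` at the letters `x + 1, …, x + k`. -/
def history (x k : ℕ) : List HistoryStep := (List.range' x k).map (historyStep σ)

theorem history_succ (x k : ℕ) :
    history σ x (k + 1) = historyStep σ x :: history σ (x + 1) k := rfl

theorem decide_toNat (p : Prop) [Decidable p] : (decide p).toNat = if p then 1 else 0 := by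
  split_ifs with h <;> simp [h]

theorem leftEmb_add_rightEmb_add_top {x : ℕ} (hx : x < m) :
    leftEmb σ (x + 1) + rightEmb σ (x + 1) + (historyStep σ x).1.toNat = height σ x := by
  rw [height_eq_embracing_add_top, leftEmb_add_rightEmb σ hx, historyStep, decide_toNat]

theorem height_succ_add_top (x : ℕ) : height σ (x + 1) + (historyStep σ x).1.toNat =
    height σ x + (historyStep σ x).2.1.toNat := by
  rw [height_succ_eq_embracing_add_bottom, height_eq_embracing_add_top, historyStep, decide_toNat,
    decide_toNat]
  ring

theorem historyStep_mem_allowedSteps {x : ℕ} (hx : x < m) :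
    historyStep σ x ∈ allowedSteps (height σ x) := by
  rw [mem_allowedSteps, ← leftEmb_add_rightEmb_add_top σ hx]
  simp only [historyStep]
  omega

theorem nextHeight_historyStep (x : ℕ) :
    nextHeight (height σ x) (historyStep σ x) = height σ (x + 1) := by
  rw [nextHeight, ← height_succ_add_top, Nat.add_sub_cancel]

theorem history_mem_histories {x k : ℕ} (h : x + k = m) :
    history σ x k ∈ histories k (height σ x) := by
  induction k generalizing x with
  | zero =>
    obtain rfl : x = m := h
    simp [height_self, histories, history]
  | succ k ih =>
    rw [history_succ, histories, mem_biUnion]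
    refine ⟨_, historyStep_mem_allowedSteps σ (by omega), mem_image_of_mem _ ?_⟩
    rw [nextHeight_historyStep]
    exact ih (by omega)

theorem history_injective :
    Function.Injective fun σ : Equiv.Perm (Fin m) => history σ 0 m := by
  intro σ τ h
  have hs : ∀ x < m, historyStep σ x = historyStep τ x := fun x hx =>
    List.map_inj_left.1 h x (by simpa using hx)
  refine eq_of_leftEmb_eq (fun x hx => ?_) (fun x hx => ?_) fun x hx => ?_
  · exact decide_eq_decide.1 (congrArg (fun s => s.1) (hs x hx))
  · exact decide_eq_decide.1 (congrArg (fun s => s.2.1) (hs x hx))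
  · exact congrArg (fun s => s.2.2) (hs x hx)

theorem sum_perm_history {M : Type*} [AddCommMonoid M] (f : List HistoryStep → M) :
    ∑ σ : Equiv.Perm (Fin m), f (history σ 0 m) = ∑ w ∈ histories m 0, f w := by
  -- Surjectivity is by counting: the encoding is injective and both sides have `m!` elements.
  have himage : univ.image (fun σ : Equiv.Perm (Fin m) => history σ 0 m) = histories m 0 := by
    refine eq_of_subset_of_card_le (image_subset_iff.2 fun σ _ => ?_) ?_
    · have := history_mem_histories σ (zero_add m)
      rwa [height_zero] at this
    · rw [card_histories, card_image_of_injective _ history_injective, card_univ,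
        Fintype.card_perm, Fintype.card_fin, Nat.choose_zero_right, mul_one]
  rw [← himage, sum_image fun σ _ τ _ h => history_injective h]

end Histories

/-! ### Transfer recursion for products of weights over pairs of steps. -/

section Transfer

variable {R : Type*} [CommSemiring R] (W : ℕ → HistoryStep → HistoryStep → R)

/-- The sum over the histories with `2 * n` steps from height `h` of the products of the weights
of their pairs of steps. -/
def pairSum : ℕ → ℕ → R
  | 0, h => if h = 0 then 1 else 0
  | n + 1, h => ∑ s ∈ allowedSteps h, ∑ s' ∈ allowedSteps (nextHeight h s),
      W h s s' * pairSum n (nextHeight (nextHeight h s) s')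

/-- The product of the weights of the pairs of steps of a history from height `h`. -/
def pairWeight : ℕ → List HistoryStep → R
  | h, s :: s' :: w => W h s s' * pairWeight (nextHeight (nextHeight h s) s') w
  | _, _ => 1

theorem sum_histories_pairWeight (n h : ℕ) :
    ∑ w ∈ histories (2 * n) h, pairWeight W h w = pairSum W n h := by
  induction n generalizing h with
  | zero =>
    rcases h with _ | h <;> simp [histories, pairSum, pairWeight]
  | succ n ih =>
    rw [show 2 * (n + 1) = 2 * n + 1 + 1 by ring, sum_histories_succ, pairSum]
    refine sum_congr rfl fun s _ => ?_
    rw [sum_histories_succ]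
    refine sum_congr rfl fun s' _ => ?_
    simp only [pairWeight]
    rw [← mul_sum, ih]

theorem pairWeight_history {m : ℕ} (σ : Equiv.Perm (Fin m)) (n x : ℕ) :
    pairWeight W (height σ x) (history σ x (2 * n)) = ∏ j ∈ range n,
      W (height σ (x + 2 * j)) (historyStep σ (x + 2 * j)) (historyStep σ (x + 2 * j + 1)) := by
  induction n generalizing x with
  | zero => simp [history, pairWeight]
  | succ n ih =>
    rw [show 2 * (n + 1) = 2 * n + 1 + 1 by ring, history_succ, history_succ, pairWeight,
      nextHeight_historyStep, nextHeight_historyStep, ih, prod_range_succ', mul_comm]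
    simp only [Nat.mul_zero, add_zero]
    congr 1
    refine prod_congr rfl fun j _ => ?_
    rw [show x + 1 + 1 + 2 * j = x + 2 * (j + 1) by ring]

theorem sum_perm_prod_pairs (n : ℕ) :
    ∑ σ : Equiv.Perm (Fin (2 * n)), ∏ j ∈ range n,
      W (height σ (2 * j)) (historyStep σ (2 * j)) (historyStep σ (2 * j + 1))
      = pairSum W n 0 := by
  rw [← sum_histories_pairWeight, ← sum_perm_history]
  refine sum_congr rfl fun σ _ => ?_
  have := pairWeight_history W σ n 0
  rw [height_zero] at this
  rw [this]
  simp only [zero_add]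

end Transfer

/-! ### Pair weights, `(p,q)`-numbers and comparison of the recursions. -/

section Weights

variable {R : Type*} [CommSemiring R] (p q t u : R)

/-- The number of right-embracings at the step `s` from height `h`. -/
def stepRight (h : ℕ) (s : HistoryStep) : ℕ := h - s.2.2 - s.1.toNat

/-- The weight of a pair of steps that counts embracings and marks the descent bottoms by `t`. -/
def embWeight (h : ℕ) (s s' : HistoryStep) : R :=
  p ^ (stepRight h s + stepRight (nextHeight h s) s') * q ^ (s.2.2 + s'.2.2) * t ^ s.2.1.toNat

/-- A pair of steps in which only the first letter may be a descent bottom and only the second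
letter may be a descent top. -/
abbrev IsEvenOddPair (s s' : HistoryStep) : Prop := s.1 = false ∧ s'.2.1 = false

/-- A pair of steps of an `E`-permutation. -/
abbrev IsEPair (s s' : HistoryStep) : Prop :=
  IsEvenOddPair s s' ∧ ¬ (s.2.1 = true ∧ s'.1 = true)

/-- A pair of steps of a normalized `E`-permutation. -/
abbrev IsNormalizedPair (h : ℕ) (s s' : HistoryStep) : Prop :=
  IsEPair s s' ∧
    (s.2.1 = true → (Even h → Even s'.2.2) ∧ (Odd h → Even s.2.2)) ∧
    (s'.1 = true → (Odd h → Even (stepRight h s)) ∧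
      (Even h → Even (stepRight (nextHeight h s) s')))

/-- The weight of a pair of steps of an even-odd descent permutation. -/
def evenOddWeight (h : ℕ) (s s' : HistoryStep) : R :=
  if IsEvenOddPair s s' then embWeight p q t h s s' else 0

/-- The weight of a pair of steps of an `E`-permutation, where `u` marks the pairs without
descent tops and bottoms. -/
def eWeight (h : ℕ) (s s' : HistoryStep) : R :=
  if IsEPair s s' then embWeight p q t h s s' * u ^ (!s.2.1 && !s'.1).toNat else 0

/-- The reduced weight of a pair of steps of a normalized `E`-permutation. -/
def normalizedWeight (h : ℕ) (s s' : HistoryStep) : R :=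
  if IsNormalizedPair h s s' then
    p ^ (stepRight h s + stepRight (nextHeight h s) s' - s.2.1.toNat) *
      q ^ (s.2.2 + s'.2.2 - s'.1.toNat) * t ^ s.2.1.toNat
  else 0

/-- The `(p,q)`-analogue of the natural number `h`. -/
def pqNumber (h : ℕ) : R := ∑ l ∈ range h, p ^ (h - 1 - l) * q ^ l

theorem sum_range_two_mul {M : Type*} [AddCommMonoid M] (f : ℕ → M) (k : ℕ) :
    ∑ l ∈ range (2 * k), f l = ∑ i ∈ range k, (f (2 * i) + f (2 * i + 1)) := by
  induction k with
  | zero => simp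
  | succ k ih =>
    rw [show 2 * (k + 1) = 2 * k + 1 + 1 by ring, sum_range_succ, sum_range_succ, sum_range_succ,
      ih, add_assoc]

theorem pqNumber_two_mul (k : ℕ) :
    pqNumber p q (2 * k) = (p + q) * ∑ i ∈ range k, p ^ (2 * (k - 1 - i)) * q ^ (2 * i) := by
  rw [pqNumber, sum_range_two_mul, mul_sum]
  refine sum_congr rfl fun i hi => ?_
  have := mem_range.1 hi
  rw [show 2 * k - 1 - 2 * i = 2 * (k - 1 - i) + 1 by omega,
    show 2 * k - 1 - (2 * i + 1) = 2 * (k - 1 - i) by omega]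
  ring

/-- The sum of the reduced weights of the normalized ascending pairs at height `h`. -/
def upSum (h : ℕ) : R := ∑ l ∈ range (h + 1), ∑ l' ∈ range (h + 2),
  if (Even h → Even l') ∧ (Odd h → Even l) then
    p ^ (h - l + (h + 1 - l') - 1) * q ^ (l + l') else 0

/-- The sum of the reduced weights of the normalized descending pairs at height `h`. -/
def downSum (h : ℕ) : R := ∑ l ∈ range (h + 1), ∑ l' ∈ range h,
  if (Odd h → Even (h - l)) ∧ (Even h → Even (h - l' - 1)) then
    p ^ (h - l + (h - l' - 1)) * q ^ (l + l' - 1) else 0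

/-- The factor of even index is `[h+2]` for even `h` and `[h+1]` for odd `h`; the parity test in
`upSum` keeps its terms with even `q`-exponent. Their `p`-exponent is odd, so the subtracted 1 is
genuine. -/
theorem pqNumber_mul_pqNumber_eq_upSum (h : ℕ) :
    pqNumber p q (h + 1) * pqNumber p q (h + 2) = (p + q) * upSum p q h := by
  obtain ⟨a, rfl | rfl⟩ := Nat.even_or_odd' h
  · rw [show 2 * a + 2 = 2 * (a + 1) by ring, pqNumber_two_mul, mul_left_comm, pqNumber, upSum,
      sum_mul]
    congr 1
    refine sum_congr rfl fun l hl => ?_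
    rw [show 2 * a + 2 = 2 * (a + 1) by ring, sum_range_two_mul, mul_sum]
    refine sum_congr rfl fun i hi => ?_
    have hl := mem_range.1 hl
    have hi := mem_range.1 hi
    rw [if_pos (by grind), if_neg (by grind), add_zero,
      show 2 * a - l + (2 * a + 1 - 2 * i) - 1 = (2 * a + 1 - 1 - l) + 2 * (a + 1 - 1 - i) by omega]
    ring
  · rw [show 2 * a + 1 + 1 = 2 * (a + 1) by ring, pqNumber_two_mul, mul_assoc, pqNumber, upSum,
      show 2 * a + 1 + 1 = 2 * (a + 1) by ring, sum_range_two_mul, sum_mul]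
    congr 1
    refine sum_congr rfl fun i hi => ?_
    rw [← sum_add_distrib, mul_sum]
    refine sum_congr rfl fun l hl => ?_
    have hl := mem_range.1 hl
    have hi := mem_range.1 hi
    rw [if_pos (by grind), if_neg (by grind), add_zero,
      show 2 * a + 1 - 2 * i + (2 * (a + 1) - l) - 1
        = (2 * a + 1 + 2 - 1 - l) + 2 * (a + 1 - 1 - i) by omega]
    ring

theorem pqNumber_mul_pqNumber_eq_downSum (h : ℕ) :
    pqNumber p q (h + 1) * pqNumber p q h = (p + q) * downSum p q h := by
  obtain ⟨a, rfl | rfl⟩ := Nat.even_or_odd' h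
  · rw [pqNumber_two_mul, mul_left_comm, pqNumber, downSum, sum_mul]
    congr 1
    refine sum_congr rfl fun l hl => ?_
    rw [sum_range_two_mul, mul_sum]
    refine sum_congr rfl fun i hi => ?_
    have hl := mem_range.1 hl
    have hi := mem_range.1 hi
    -- Here the even number is the right-embracing one, so the odd `l'` survive and supply the `q`
    -- that is removed.
    rw [if_neg (by grind), if_pos (by grind), zero_add,
      show 2 * a - l + (2 * a - (2 * i + 1) - 1) = (2 * a + 1 - 1 - l) + 2 * (a - 1 - i) by omega,
      show l + (2 * i + 1) - 1 = l + 2 * i by omega]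
    ring
  · rw [show 2 * a + 1 + 1 = 2 * (a + 1) by ring, pqNumber_two_mul, mul_assoc, pqNumber, downSum,
      show 2 * a + 1 + 1 = 2 * (a + 1) by ring, sum_range_two_mul, sum_mul]
    congr 1
    refine sum_congr rfl fun i hi => ?_
    rw [← sum_add_distrib, mul_sum]
    refine sum_congr rfl fun l hl => ?_
    have hl := mem_range.1 hl
    have hi := mem_range.1 hi
    rw [if_neg (by grind), if_pos (by grind), zero_add,
      show 2 * a + 1 - (2 * i + 1) + (2 * a + 1 - l - 1)
        = (2 * a + 1 - 1 - l) + 2 * (a + 1 - 1 - i) by omega,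
      show 2 * i + 1 + l - 1 = l + 2 * i by omega]
    ring

theorem pqNumber_mul_pqNumber (h k : ℕ) : pqNumber p q h * pqNumber p q k =
    ∑ l ∈ range h, ∑ l' ∈ range k, p ^ (h - 1 - l + (k - 1 - l')) * q ^ (l + l') := by
  rw [pqNumber, pqNumber, sum_mul_sum]
  refine sum_congr rfl fun l _ => sum_congr rfl fun l' _ => ?_
  ring

/-- The truncated `h - 1` is harmless: at `h = 0` its coefficient is an empty sum. -/
theorem pairSum_succ_of_evenOdd {W : ℕ → HistoryStep → HistoryStep → R}
    (hW : ∀ h s s', ¬ IsEvenOddPair s s' → W h s s' = 0) (n h : ℕ) :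
    pairSum W (n + 1) h =
      ((∑ l ∈ range (h + 1), ∑ l' ∈ range (h + 1), W h (false, false, l) (false, false, l')) +
        ∑ l ∈ range (h + 1), ∑ l' ∈ range (h + 1), W h (false, true, l) (true, false, l')) *
          pairSum W n h +
      (∑ l ∈ range (h + 1), ∑ l' ∈ range (h + 2), W h (false, true, l) (false, false, l')) *
          pairSum W n (h + 1) +
      (∑ l ∈ range (h + 1), ∑ l' ∈ range h, W h (false, false, l) (true, false, l')) *
          pairSum W n (h - 1) := by
  have h1 : ∀ b l s', W h (true, b, l) s' = 0 := fun b l s' => hW _ _ _ (by simp)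
  have h2 : ∀ b l s, W h s (b, true, l) = 0 := fun b l s => hW _ _ _ (by simp)
  rw [pairSum, sum_allowedSteps]
  simp only [sum_allowedSteps, h1, h2, zero_mul, sum_const_zero, add_zero, nextHeight,
    Bool.toNat_true, Bool.toNat_false, Nat.sub_zero, Nat.add_sub_cancel, sum_add_distrib, ← sum_mul]
  ring

theorem pairSum_evenOddWeight_succ (n h : ℕ) :
    pairSum (evenOddWeight p q t) (n + 1) h =
      (1 + t) * (pqNumber p q (h + 1) * pqNumber p q (h + 1)) * pairSum (evenOddWeight p q t) n h +
      t * (pqNumber p q (h + 1) * pqNumber p q (h + 2)) * pairSum (evenOddWeight p q t) n (h + 1) +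
      pqNumber p q (h + 1) * pqNumber p q h * pairSum (evenOddWeight p q t) n (h - 1) := by
  rw [pairSum_succ_of_evenOdd (W := evenOddWeight p q t)
    fun h s s' hs => if_neg hs]
  simp only [evenOddWeight, IsEvenOddPair, and_self, reduceIte, embWeight, stepRight, nextHeight,
    pqNumber_mul_pqNumber, Bool.toNat_true, Bool.toNat_false, add_zero, Nat.sub_zero,
    Nat.add_sub_cancel, pow_zero, pow_one, mul_one, ← sum_mul, Nat.sub_right_comm _ _ 1,
    show h + 2 - 1 = h + 1 from rfl]
  ring

theorem pairSum_eWeight_succ (n h : ℕ) :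
    pairSum (eWeight p q t u) (n + 1) h =
      u * (pqNumber p q (h + 1) * pqNumber p q (h + 1)) * pairSum (eWeight p q t u) n h +
      t * (pqNumber p q (h + 1) * pqNumber p q (h + 2)) * pairSum (eWeight p q t u) n (h + 1) +
      pqNumber p q (h + 1) * pqNumber p q h * pairSum (eWeight p q t u) n (h - 1) := by
  rw [pairSum_succ_of_evenOdd (W := eWeight p q t u)
    fun h s s' hs => if_neg fun hs' => hs hs'.1]
  simp only [eWeight, IsEPair, IsEvenOddPair, and_self, and_true, and_false, not_true,
    not_false_eq_true, Bool.false_eq_true, reduceIte, embWeight, stepRight, nextHeight,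
    pqNumber_mul_pqNumber, Bool.toNat_true, Bool.toNat_false, Bool.not_true, Bool.not_false,
    Bool.and_true, Bool.and_false, add_zero, Nat.sub_zero,
    Nat.add_sub_cancel, pow_zero, pow_one, mul_one, ← sum_mul, Nat.sub_right_comm _ _ 1,
    show h + 2 - 1 = h + 1 from rfl, sum_const_zero]
  ring

theorem pairSum_normalizedWeight_succ (n h : ℕ) :
    pairSum (normalizedWeight p q t) (n + 1) h =
      pqNumber p q (h + 1) * pqNumber p q (h + 1) * pairSum (normalizedWeight p q t) n h +
      t * upSum p q h * pairSum (normalizedWeight p q t) n (h + 1) +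
      downSum p q h * pairSum (normalizedWeight p q t) n (h - 1) := by
  rw [pairSum_succ_of_evenOdd (W := normalizedWeight p q t)
    fun h s s' hs => if_neg fun hs' => hs hs'.1.1]
  simp only [normalizedWeight, IsNormalizedPair, IsEPair, IsEvenOddPair, and_self, and_true,
    and_false, false_and, true_and, not_true, not_false_eq_true, Bool.false_eq_true, false_imp_iff,
    true_imp_iff, reduceIte, stepRight, nextHeight, upSum, downSum,
    pqNumber_mul_pqNumber, Bool.toNat_true, Bool.toNat_false, add_zero, Nat.sub_zero,
    Nat.add_sub_cancel, pow_zero, pow_one, mul_one, ← sum_mul, ← ite_zero_mul]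
  simp only [sum_const_zero, zero_mul, add_zero]
  ring

/-- Both recursions have level coefficient `(1 + t) [h+1]^2`. -/
theorem pairSum_evenOddWeight_eq_eWeight (n h : ℕ) :
    pairSum (evenOddWeight p q t) n h = pairSum (eWeight p q t (1 + t)) n h := by
  induction n generalizing h with
  | zero => rfl
  | succ n ih => rw [pairSum_evenOddWeight_succ, pairSum_eWeight_succ, ih, ih, ih]

/-- The power `(p + q)^h` shifts the factor of each down pair onto an up pair, where `t` already
marks it. -/
theorem pairSum_eWeight_eq_normalizedWeight (n h : ℕ) :
    pairSum (eWeight p q t 1) n h =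
      (p + q) ^ h * pairSum (normalizedWeight p q ((p + q) ^ 2 * t)) n h := by
  induction n generalizing h with
  | zero => rcases h with _ | h <;> simp [pairSum]
  | succ n ih =>
    rw [pairSum_eWeight_succ, pairSum_normalizedWeight_succ, ih, ih, ih,
      pqNumber_mul_pqNumber_eq_upSum, pqNumber_mul_pqNumber_eq_downSum]
    rcases h with _ | h
    · simp only [downSum, range_zero, sum_empty, sum_const_zero]
      ring
    · rw [Nat.add_sub_cancel]
      ring

end Weights

/-! ### Pairwise form of the classes of permutations and of their statistics. -/

section EvenOddPermutations

variable {n : ℕ} (σ : Equiv.Perm (Fin (2 * n)))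

theorem isEvenOddDescent_iff_pairs : IsEvenOddDescent σ ↔
    ∀ j ∈ range n, IsEvenOddPair (historyStep σ (2 * j)) (historyStep σ (2 * j + 1)) := by
  simp only [IsEvenOddPair, historyStep, decide_eq_false_iff_not, descentTops, descentBottoms,
    mem_image, not_exists, not_and, mem_range]
  constructor
  · intro h j _
    refine ⟨fun d hd hx => ?_, fun d hd hx => ?_⟩
    · have := (h d hd).1; grind
    · have := (h d hd).2; grind
  · intro h d hd
    have h1 := letter_le σ d.1
    have h2 := letter_le σ d.2
    have h3 := one_le_letter σ d.1
    have h4 := one_le_letter σ d.2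
    constructor
    · by_contra hodd
      obtain ⟨j, hj⟩ := Nat.not_even_iff_odd.1 hodd
      exact (h j (by omega)).1 d hd hj
    · by_contra heven
      obtain ⟨j, hj⟩ := Nat.not_odd_iff_even.1 heven
      exact (h (j - 1) (by omega)).2 d hd (by omega)

theorem forall_mem_Icc_one_iff {P : ℕ → Prop} :
    (∀ j ∈ Icc 1 n, P j) ↔ ∀ j ∈ range n, P (j + 1) := by
  simp only [mem_Icc, mem_range]
  refine ⟨fun h j hj => h _ ⟨by omega, by omega⟩, fun h j hj => ?_⟩
  have := h (j - 1) (by omega)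
  rwa [Nat.sub_add_cancel hj.1] at this

theorem isEPerm_iff_pairs : IsEPerm σ ↔
    ∀ j ∈ range n, IsEPair (historyStep σ (2 * j)) (historyStep σ (2 * j + 1)) := by
  rw [IsEPerm, isEvenOddDescent_iff_pairs, forall_mem_Icc_one_iff, ← forall₂_and]
  simp only [IsEPair, historyStep, decide_eq_true_iff]
  rfl

theorem height_add_card_tops {m : ℕ} (σ : Equiv.Perm (Fin m)) (x : ℕ) :
    height σ x + ((descents σ).filter fun d => letter σ d.1 ≤ x).card
      = ((descents σ).filter fun d => letter σ d.2 ≤ x).card := by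
  rw [height, openDescents, ← card_union_of_disjoint]
  · congr 1
    ext d
    simp only [mem_union, mem_filter]
    have : d ∈ descents σ → letter σ d.2 < letter σ d.1 := fun h => ((mem_descents σ).1 h).2
    grind
  · refine disjoint_left.2 fun d hd he => ?_
    simp only [mem_filter] at hd he
    omega

theorem card_odd_sigSet {m : ℕ} {σ : Equiv.Perm (Fin m)} (hσ : IsEvenOddDescent σ) (x : ℕ) :
    ((sigSet σ).filter fun y => Odd y ∧ y < x + 1).card
      = ((descents σ).filter fun d => letter σ d.2 ≤ x).card := by
  rw [← card_image_of_injOn (f := fun d : Fin m × Fin m => letter σ d.2)]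
  · congr 1
    ext y
    simp only [sigSet, descentTops, descentBottoms, mem_filter, mem_union, mem_image,
      Nat.lt_succ_iff]
    constructor
    · rintro ⟨⟨d, hd, rfl⟩ | ⟨d, hd, rfl⟩, h1, h2⟩
      · exact absurd (hσ d hd).1 (Nat.not_even_iff_odd.2 h1)
      · exact ⟨d, ⟨hd, h2⟩, rfl⟩
    · rintro ⟨d, ⟨hd, h2⟩, rfl⟩
      exact ⟨Or.inr ⟨d, hd, rfl⟩, (hσ d hd).2, h2⟩
  · intro d hd e he h
    simp only [coe_filter, Set.mem_ofPred_eq] at hd he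
    exact descents_eq_of_snd_eq σ hd.1 he.1 (letter_injective σ h)

theorem card_even_sigSet {m : ℕ} {σ : Equiv.Perm (Fin m)} (hσ : IsEvenOddDescent σ) (x : ℕ) :
    ((sigSet σ).filter fun y => Even y ∧ y < x + 1).card
      = ((descents σ).filter fun d => letter σ d.1 ≤ x).card := by
  rw [← card_image_of_injOn (f := fun d : Fin m × Fin m => letter σ d.1)]
  · congr 1
    ext y
    simp only [sigSet, descentTops, descentBottoms, mem_filter, mem_union, mem_image,
      Nat.lt_succ_iff]
    constructor
    · rintro ⟨⟨d, hd, rfl⟩ | ⟨d, hd, rfl⟩, h1, h2⟩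
      · exact ⟨d, ⟨hd, h2⟩, rfl⟩
      · exact absurd (hσ d hd).2 (Nat.not_odd_iff_even.2 h1)
    · rintro ⟨d, ⟨hd, h2⟩, rfl⟩
      exact ⟨Or.inl ⟨d, hd, rfl⟩, (hσ d hd).1, h2⟩
  · intro d hd e he h
    simp only [coe_filter, Set.mem_ofPred_eq] at hd he
    exact descents_eq_of_fst_eq σ hd.1 he.1 (letter_injective σ h)

/-- The odd elements of `S` are the bottoms and the even ones the tops, so their difference counts
open descents. -/
theorem sig_succ_eq_height {m : ℕ} {σ : Equiv.Perm (Fin m)} (hσ : IsEvenOddDescent σ) {x : ℕ}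
    (hx : x + 1 ∈ sigSet σ) : sig σ (x + 1) = height σ x + if Odd (x + 1) then 1 else 0 := by
  have h := height_add_card_tops σ x
  rw [sig, card_odd_sigSet hσ, card_even_sigSet hσ, ← h]
  simp only [hx, true_and, not_true, or_false]
  push_cast
  ring

theorem stepRight_historyStep {m : ℕ} (σ : Equiv.Perm (Fin m)) {x : ℕ} (hx : x < m) :
    stepRight (height σ x) (historyStep σ x) = rightEmb σ (x + 1) := by
  rw [← leftEmb_add_rightEmb_add_top σ hx, stepRight]
  simp only [historyStep]
  omega

theorem isNormalizedEPerm_iff_pairs : IsNormalizedEPerm σ ↔ ∀ j ∈ range n,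
    IsNormalizedPair (height σ (2 * j)) (historyStep σ (2 * j)) (historyStep σ (2 * j + 1)) := by
  rw [IsNormalizedEPerm, isEPerm_iff_pairs, forall_mem_Icc_one_iff]
  refine Iff.trans (and_congr_right fun hE => forall₂_congr fun j hj => ?_) forall₂_and.symm
  have hσ : IsEvenOddDescent σ := ((isEPerm_iff_pairs σ).2 hE).1
  have hj' := mem_range.1 hj
  obtain ⟨⟨htop, hbot⟩, hbt⟩ := hE j hj
  rw [nextHeight_historyStep, stepRight_historyStep σ (by omega),
    stepRight_historyStep σ (by omega)]
  have hnext := height_succ_add_top σ (2 * j)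
  rw [htop] at hnext
  simp only [historyStep, decide_eq_false_iff_not, decide_eq_true_iff] at *
  have h1 : 2 * j + 1 ∈ sigSet σ ↔ 2 * j + 1 ∈ descentBottoms σ := by
    simp [sigSet, htop]
  have h2 : 2 * j + 1 + 1 ∈ sigSet σ ↔ 2 * j + 1 + 1 ∈ descentTops σ := by
    simp [sigSet, hbot]
  have s1 : 2 * j + 1 ∈ sigSet σ → sig σ (2 * j + 1) = ((height σ (2 * j) + 1 : ℕ) : ℤ) :=
    fun h => by
      rw [sig_succ_eq_height hσ h, if_pos (by grind)]
      push_cast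
      rfl
  have s2 : 2 * j + 1 + 1 ∈ sigSet σ → sig σ (2 * j + 1 + 1) = ((height σ (2 * j) : ℕ) : ℤ) :=
    fun h => by
      -- The `E`-condition keeps the height constant across the odd letter. So both signatures are
      -- governed by the height at the start of the pair, with opposite parities.
      have hb : 2 * j + 1 ∉ descentBottoms σ := fun hb => hbt ⟨hb, h2.1 h⟩
      rw [sig_succ_eq_height hσ h, if_neg (by grind), add_zero]
      simp only [hb, decide_false, Bool.toNat_false, add_zero] at hnext
      rw [hnext]
  rw [show 2 * (j + 1) - 1 = 2 * j + 1 by omega, show 2 * (j + 1) = 2 * j + 1 + 1 by ring]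
  by_cases c1 : 2 * j + 1 ∈ sigSet σ <;> by_cases c2 : 2 * j + 1 + 1 ∈ sigSet σ
  · exact absurd ⟨h1.1 c1, h2.1 c2⟩ hbt
  · simp only [c1, h1.1 c1, c2, mt h2.2 c2, true_and, false_and, false_imp_iff, and_true,
      true_imp_iff, s1 c1, Int.odd_coe_nat, Int.even_coe_nat, Nat.odd_add_one, Nat.even_add_one,
      Nat.not_odd_iff_even, Nat.not_even_iff_odd]
  · simp only [c2, h2.1 c2, c1, mt h1.2 c1, true_and, false_and, false_imp_iff,
      true_imp_iff, s2 c2, Int.odd_coe_nat, Int.even_coe_nat]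
  · simp only [c2, mt h2.2 c2, c1, mt h1.2 c1, false_and, false_imp_iff, and_true]

theorem les_eq_sum_pairs : les σ = ∑ j ∈ range n,
    ((historyStep σ (2 * j)).2.2 + (historyStep σ (2 * j + 1)).2.2) := by
  rw [les_eq_sum, sum_range_two_mul]
  rfl

theorem res_eq_sum_pairs : res σ = ∑ j ∈ range n,
    (stepRight (height σ (2 * j)) (historyStep σ (2 * j)) +
      stepRight (nextHeight (height σ (2 * j)) (historyStep σ (2 * j)))
        (historyStep σ (2 * j + 1))) := by
  rw [res_eq_sum, sum_range_two_mul]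
  refine sum_congr rfl fun j hj => ?_
  have := mem_range.1 hj
  rw [nextHeight_historyStep, stepRight_historyStep σ (by omega),
    stepRight_historyStep σ (by omega)]

variable {σ}

theorem des_eq_sum_pairs_bottom (hσ : IsEvenOddDescent σ) :
    des σ = ∑ j ∈ range n, (historyStep σ (2 * j)).2.1.toNat := by
  rw [des_eq_sum_bottoms, sum_range_two_mul]
  refine sum_congr rfl fun j hj => ?_
  have h := ((isEvenOddDescent_iff_pairs σ).1 hσ j hj).2
  simp only [historyStep, decide_eq_false_iff_not] at h
  rw [if_neg h, add_zero, historyStep, decide_toNat]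

theorem des_eq_sum_pairs_top (hσ : IsEvenOddDescent σ) :
    des σ = ∑ j ∈ range n, (historyStep σ (2 * j + 1)).1.toNat := by
  rw [des_eq_sum_tops, sum_range_two_mul]
  refine sum_congr rfl fun j hj => ?_
  have h := ((isEvenOddDescent_iff_pairs σ).1 hσ j hj).1
  simp only [historyStep, decide_eq_false_iff_not] at h
  rw [if_neg h, zero_add, historyStep, decide_toNat]

/-- Each pair contains exactly one of: a bottom, a top, or neither. -/
theorem two_mul_des_add_sum_pairs (hσ : IsEPerm σ) :
    2 * des σ + ∑ j ∈ range n,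
      (!(historyStep σ (2 * j)).2.1 && !(historyStep σ (2 * j + 1)).1).toNat = n := by
  rw [two_mul]
  nth_rw 1 [des_eq_sum_pairs_bottom hσ.1]
  rw [des_eq_sum_pairs_top hσ.1, ← sum_add_distrib, ← sum_add_distrib]
  refine (sum_congr rfl fun j hj => ?_).trans ((sum_const 1).trans (by simp))
  have h := ((isEPerm_iff_pairs σ).1 hσ j hj).2
  revert h
  cases (historyStep σ (2 * j)).2.1 <;> cases (historyStep σ (2 * j + 1)).1 <;> simp

/-- Normalization forces an odd, hence positive, right-embracing number in an up pair and
left-embracing number in a down pair. This makes the subtractions in `normalizedWeight` genuine. -/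
theorem pair_le_of_isNormalizedPair {h : ℕ} {s s' : HistoryStep} (hs : s ∈ allowedSteps h)
    (hs' : s' ∈ allowedSteps (nextHeight h s)) (hn : IsNormalizedPair h s s') :
    s.2.1.toNat ≤ stepRight h s + stepRight (nextHeight h s) s' ∧
      s'.1.toNat ≤ s.2.2 + s'.2.2 := by
  obtain ⟨top, bot, l⟩ := s
  obtain ⟨top', bot', l'⟩ := s'
  obtain ⟨⟨⟨rfl, rfl⟩, hbt⟩, hb, ht⟩ := hn
  rw [mem_allowedSteps] at hs hs'
  cases bot <;> cases top' <;>
    simp only [stepRight, nextHeight, Bool.toNat_true, Bool.toNat_false, true_imp_iff] at * <;>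
    rcases Nat.even_or_odd h with he | he <;> grind

theorem normalized_pair_le (hσ : IsNormalizedEPerm σ) {j : ℕ} (hj : j ∈ range n) :
    (historyStep σ (2 * j)).2.1.toNat ≤
      stepRight (height σ (2 * j)) (historyStep σ (2 * j)) +
      stepRight (nextHeight (height σ (2 * j)) (historyStep σ (2 * j)))
        (historyStep σ (2 * j + 1)) ∧
    (historyStep σ (2 * j + 1)).1.toNat ≤
      (historyStep σ (2 * j)).2.2 + (historyStep σ (2 * j + 1)).2.2 := by
  have := mem_range.1 hj
  refine pair_le_of_isNormalizedPair (historyStep_mem_allowedSteps σ (by omega)) ?_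
    ((isNormalizedEPerm_iff_pairs σ).1 hσ j hj)
  rw [nextHeight_historyStep]
  exact historyStep_mem_allowedSteps σ (by omega)

theorem des_le_les_and_res (hσ : IsNormalizedEPerm σ) : des σ ≤ les σ ∧ des σ ≤ res σ := by
  refine ⟨?_, ?_⟩
  · rw [des_eq_sum_pairs_top hσ.1.1, les_eq_sum_pairs]
    exact sum_le_sum fun j hj => (normalized_pair_le hσ hj).2
  · rw [des_eq_sum_pairs_bottom hσ.1.1, res_eq_sum_pairs]
    exact sum_le_sum fun j hj => (normalized_pair_le hσ hj).1

end EvenOddPermutations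

/-! ### Generating functions as pair sums. -/

section GeneratingFunctions

variable {R : Type*} [CommSemiring R] (p q t u : R) {n : ℕ}

theorem prod_embWeight {σ : Equiv.Perm (Fin (2 * n))} (hσ : IsEvenOddDescent σ) :
    ∏ j ∈ range n, embWeight p q t (height σ (2 * j)) (historyStep σ (2 * j))
      (historyStep σ (2 * j + 1)) = p ^ res σ * q ^ les σ * t ^ des σ := by
  simp only [embWeight]
  rw [prod_mul_distrib, prod_mul_distrib, prod_pow_eq_pow_sum, prod_pow_eq_pow_sum,
    prod_pow_eq_pow_sum, ← res_eq_sum_pairs, ← les_eq_sum_pairs, ← des_eq_sum_pairs_bottom hσ]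

theorem sum_evenOdd_eq_pairSum (n : ℕ) :
    ∑ σ ∈ evenOddPerms n, p ^ res σ * q ^ les σ * t ^ des σ
      = pairSum (evenOddWeight p q t) n 0 := by
  rw [← sum_perm_prod_pairs, evenOddPerms, sum_filter]
  refine sum_congr rfl fun σ _ => ?_
  simp only [evenOddWeight]
  rw [prod_ite_zero]
  refine if_ctx_congr (isEvenOddDescent_iff_pairs σ) (fun h => ?_) fun _ => rfl
  rw [prod_embWeight p q t ((isEvenOddDescent_iff_pairs σ).2 h)]

theorem sum_isEPerm_eq_pairSum (n : ℕ) :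
    ∑ σ : Equiv.Perm (Fin (2 * n)) with IsEPerm σ,
      p ^ res σ * q ^ les σ * t ^ des σ * u ^ (n - 2 * des σ) = pairSum (eWeight p q t u) n 0 := by
  rw [← sum_perm_prod_pairs, sum_filter]
  refine sum_congr rfl fun σ _ => ?_
  simp only [eWeight]
  rw [prod_ite_zero]
  refine if_ctx_congr (isEPerm_iff_pairs σ) (fun h => ?_) fun _ => rfl
  rw [← isEPerm_iff_pairs] at h
  rw [prod_mul_distrib, prod_embWeight p q t h.1, prod_pow_eq_pow_sum]
  have := two_mul_des_add_sum_pairs h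
  congr 2
  omega

theorem sum_isNormalizedEPerm_eq_pairSum (n : ℕ) :
    ∑ σ : Equiv.Perm (Fin (2 * n)) with IsNormalizedEPerm σ,
      p ^ (res σ - des σ) * q ^ (les σ - des σ) * t ^ des σ
      = pairSum (normalizedWeight p q t) n 0 := by
  rw [← sum_perm_prod_pairs, sum_filter]
  refine sum_congr rfl fun σ _ => ?_
  simp only [normalizedWeight]
  rw [prod_ite_zero]
  refine if_ctx_congr (isNormalizedEPerm_iff_pairs σ) (fun h => ?_) fun _ => rfl
  rw [← isNormalizedEPerm_iff_pairs] at h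
  rw [prod_mul_distrib, prod_mul_distrib, prod_pow_eq_pow_sum, prod_pow_eq_pow_sum,
    prod_pow_eq_pow_sum, sum_tsub_distrib _ fun j hj => (normalized_pair_le h hj).1,
    sum_tsub_distrib _ fun j hj => (normalized_pair_le h hj).2, ← res_eq_sum_pairs,
    ← les_eq_sum_pairs, ← des_eq_sum_pairs_bottom h.1.1, ← des_eq_sum_pairs_top h.1.1]

open Polynomial in
theorem coeff_sum_filter_C_mul_X_pow {ι : Type*} (s : Finset ι) (f : ι → R) (d : ι → ℕ) (k : ℕ) :
    (∑ i ∈ s, C (f i) * X ^ d i).coeff k = ∑ i ∈ s with d i = k, f i := by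
  rw [finsetSum_coeff, sum_filter]
  refine sum_congr rfl fun i _ => ?_
  rw [coeff_C_mul_X_pow]
  simp only [eq_comm]

end GeneratingFunctions

/-! ### Gamma expansion and extraction of coefficients. -/

section Gamma

variable {R : Type*} [CommRing R] (n : ℕ) (p q t : R)

theorem ePerms_eq_filter (k : ℕ) :
    ePerms n k = {σ ∈ ({σ | IsEPerm σ} : Finset (Equiv.Perm (Fin (2 * n)))) | des σ = k} := by
  rw [filter_filter]
  rfl

theorem normalizedEPerms_eq_filter (k : ℕ) : normalizedEPerms n k =
    {σ ∈ ({σ | IsNormalizedEPerm σ} : Finset (Equiv.Perm (Fin (2 * n)))) | des σ = k} := by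
  rw [filter_filter]
  rfl

theorem descentPoly_eq_sum_gammaCoeff : descentPoly n p q t =
    ∑ k ∈ range (n / 2 + 1), gammaCoeff n k p q * t ^ k * (1 + t) ^ (n - 2 * k) := by
  rw [descentPoly, sum_evenOdd_eq_pairSum, pairSum_evenOddWeight_eq_eWeight,
    ← sum_isEPerm_eq_pairSum, ← sum_fiberwise_of_maps_to (g := des) (t := range (n / 2 + 1))]
  · refine sum_congr rfl fun k _ => ?_
    rw [gammaCoeff, ePerms_eq_filter, sum_mul, sum_mul]
    refine sum_congr rfl fun σ hσ => ?_
    rw [(mem_filter.1 hσ).2]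
  · intro σ hσ
    have := two_mul_des_add_sum_pairs (mem_filter.1 hσ).2
    rw [mem_range]
    omega

open Polynomial in
theorem gammaCoeff_eq_mul_sum_normalizedEPerms (k : ℕ) : gammaCoeff n k p q =
    (p + q) ^ (2 * k) * ∑ σ ∈ normalizedEPerms n k, q ^ (les σ - k) * p ^ (res σ - k) := by
  -- With `t` specialized to the polynomial variable over `R`, the identity can be compared
  -- coefficient by coefficient.
  have h := pairSum_eWeight_eq_normalizedWeight (C p) (C q) X n 0
  rw [← sum_isEPerm_eq_pairSum, ← sum_isNormalizedEPerm_eq_pairSum, pow_zero, one_mul] at h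
  simp only [one_pow, mul_one, mul_pow, ← C_add, ← C_pow, ← C_mul, ← mul_assoc] at h
  replace h := congrArg (coeff · k) h
  simp only [coeff_sum_filter_C_mul_X_pow] at h
  rw [gammaCoeff, ePerms_eq_filter, h, normalizedEPerms_eq_filter, mul_sum]
  refine sum_congr rfl fun σ hσ => ?_
  rw [(mem_filter.1 hσ).2, pow_mul]
  ring

end Gamma

end

/-- For all `p, q, t` in an arbitrary commutative ring (for instance the indeterminates of
`ℤ[p, q, t]`). The first part of the second conjunct says that the exponents `les σ - k` and
`res σ - k` in the factorization are genuine (not truncated) differences. -/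
theorem mainTheorem3 {R : Type*} [CommRing R] (n : ℕ) (p q t : R) :
    descentPoly n p q t
      = ∑ k ∈ Finset.range (n / 2 + 1), gammaCoeff n k p q * t ^ k * (1 + t) ^ (n - 2 * k) ∧
    ∀ k : ℕ,
      (∀ σ ∈ normalizedEPerms n k, k ≤ les σ ∧ k ≤ res σ) ∧
      gammaCoeff n k p q
        = (p + q) ^ (2 * k) *
          ∑ σ ∈ normalizedEPerms n k, q ^ (les σ - k) * p ^ (res σ - k) :=
  ⟨descentPoly_eq_sum_gammaCoeff n p q t, fun k =>
    ⟨fun σ hσ => by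
      obtain ⟨h, rfl⟩ := (Finset.mem_filter.1 hσ).2
      exact des_le_les_and_res h,
    gammaCoeff_eq_mul_sum_normalizedEPerms n p q k⟩⟩
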